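/- An inverse semigroup is a semigroup in which every $s$ has a unique $s^\dagger$ with $ss^\dagger s=s$ and $s^\dagger ss^\dagger=s^\dagger$. Its natural partial order is: $s\le t$ iff $s=te$ for some idempotent $e$. $\mathcal E(\mathcal S)$ denotes the set of idempotents of $\mathcal S$. A Boolean inverse monoid is an inverse monoid $\mathcal S$ with $0$ such that $(\mathcal E(\mathcal S),\le)$ is a Boolean algebra, $(\mathcal S,\le)$ is a meet semilattice, and any $s,t$ with $s^\dagger t=ts^\dagger=0$ have a join in $\mathcal S$. Let $\mathcal S$ be a Boolean inverse monoid. Let $\widehat{\mathcal E(\mathcal S)}$ be the Stone space of the Boolean algebra $\mathcal E(\mathcal S)$ (its unital lattice homomorphisms into $\{0,1\}$), let $\mathcal D=C(\widehat{\mathcal E(\mathcal S)})$, and let $\mathcal P$ be the inverse semigroup of partial isometries of $\mathcal D$. Let $\mathcal P\overset{\iota}{\hookrightarrow}\mathcal G\overset{q}{\to}\mathcal S$ be an (idempotent separating) extension: $\mathcal G$ is an inverse semigroup, $\iota$ is an injective and $q$ a surjective semigroup homomorphism, $q(g)\in\mathcal E(\mathcal S)$ if and only if $g\in\iota(\mathcal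 P)$, and $q\circ\iota$ restricts to an isomorphism of $\mathcal E(\mathcal P)$ onto $\mathcal E(\mathcal S)$. Identify $\mathcal P$ with $\iota(\mathcal P)$. Fix an order preserving section $j:\mathcal S\to\mathcal G$ of $q$, that is, $q\circ j=\mathrm{id}$, $j(1)=1$, and $j(s)\le j(t)$ whenever $s\le t$. (Such a $j$ exists whenever $\mathcal E(\mathcal S)$ is a complete Boolean algebra.) For $s,t\in\mathcal S$ put $K(t,s)=j(s^\dagger t\wedge 1)\in\mathcal P\subseteq\mathcal D$ and $k_s(t)=K(t,s)$. Then $K$ is a positive $\mathcal D$-valued kernel, i.e. $\sum_{i,l}\overline{c_i}c_l K(s_i,s_l)\ge 0$ for all finite families $c_i\in\mathbb C$, $s_i\in\mathcal S$. Let $\mathfrak A$ be the completion of $\operatorname{span}_{\mathbb C}\{k_s:s\in\mathcal S\}$ in the norm $\|u\|=\|\langle u,u\rangle\|^{1/2}$ of the $\mathcal D$-valued inner product (conjugate linear in the first variable) with $\langle k_s,k_t\rangle=K(s,t)$. It is a right Hilbert $\mathcal D$-module of functions $\mathcal S\to\mathcal D$ with action $(uh)(s)=u(s)h$ and $u(s)=\langle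 k_s,u\rangle$. Equivalently, $\mathfrak A$ is the completion of the $\mathcal D$-linear span of the $k_s$, and $\operatorname{span}_{\mathbb C}\{k_s\}$ is dense in it. Let $\mathcal L(\mathfrak A)$ be the algebra of adjointable operators on $\mathfrak A$. For $v\in\mathcal G$ and $s\in\mathcal S$ put $\sigma(v,s)=j(q(v)s)^\dagger\,v\,j(s)$, which lies in $\mathcal P\subseteq\mathcal D$. **Theorem.** For every $v\in\mathcal G$ there is a unique bounded linear operator $\lambda(v)$ on $\mathfrak A$ such that $$\lambda(v)k_s=k_{q(v)s}\,\sigma(v,s)\qquad(s\in\mathcal S).$$ The operator $\lambda(v)$ belongs to $\mathcal L(\mathfrak A)$ and is a partial isometry, i.e. $\lambda(v)\lambda(v)^*\lambda(v)=\lambda(v)$. Moreover $\lambda:\mathcal G\to\mathcal L(\mathfrak A)$ is a one-to-one representation of $\mathcal G$: $\lambda(vw)=\lambda(v)\lambda(w)$ and $\lambda(v^\dagger)=\lambda(v)^*$ for all $v,w\in\mathcal G$, and $\lambda$ is injective. -/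

import Mathlib

open scoped ComplexOrder

universe u v

/-- An inverse semigroup: every `s` has a unique `dag s` with
`s (dag s) s = s` and `(dag s) s (dag s) = dag s`. -/
class InverseSemigroup (S : Type u) extends Semigroup S where
  dag : S → S
  mul_dag_mul : ∀ s : S, s * dag s * s = s
  dag_mul_dag : ∀ s : S, dag s * s * dag s = dag s
  dag_unique : ∀ s t : S, s * t * s = s → t * s * t = t → t = dag s

namespace InverseSemigroup

/-- The set of idempotents of a semigroup, as a type. -/
structure Idem (S : Type u) [Mul S] where
  val : S
  isIdem : IsIdempotentElem val

/-- The natural partial order: `s ≤ t` iff `s = t e` for some idempotent `e`. -/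
def NatLE {S : Type u} [Mul S] (s t : S) : Prop :=
  ∃ e : S, IsIdempotentElem e ∧ s = t * e

section basic

variable {S : Type u} [InverseSemigroup S]

lemma dag_dag (s : S) : dag (dag s) = s :=
  (dag_unique (dag s) s (dag_mul_dag s) (mul_dag_mul s)).symm

lemma dag_idem {e : S} (he : IsIdempotentElem e) : dag e = e :=
  (dag_unique e e (by rw [he.eq, he.eq]) (by rw [he.eq, he.eq])).symm

lemma isIdem_dag_mul (s : S) : IsIdempotentElem (dag s * s) := by
  unfold IsIdempotentElem
  rw [← mul_assoc, dag_mul_dag]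

lemma isIdem_mul_dag (s : S) : IsIdempotentElem (s * dag s) := by
  unfold IsIdempotentElem
  rw [← mul_assoc, mul_dag_mul]

lemma isIdem_mul {e f : S} (he : IsIdempotentElem e) (hf : IsIdempotentElem f) :
    IsIdempotentElem (e * f) := by
  have he2 : ∀ z, e * (e * z) = e * z := fun z => by rw [← mul_assoc, he.eq]
  have hf2 : ∀ z, f * (f * z) = f * z := fun z => by rw [← mul_assoc, hf.eq]
  obtain ⟨x, hx⟩ : ∃ x, x = dag (e * f) := ⟨_, rfl⟩
  have h1 : e * f * x * (e * f) = e * f := by rw [hx]; exact mul_dag_mul _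
  have h2 : x * (e * f) * x = x := by rw [hx]; exact dag_mul_dag _
  have h2a : ∀ z, x * (e * (f * (x * z))) = x * z := fun z => by
    have := congrArg (· * z) h2
    simpa only [mul_assoc] using this
  have h3 : f * x * e = x := by
    rw [hx]
    refine dag_unique (e * f) _ ?_ ?_
    · rw [← hx]
      simp only [mul_assoc] at h1 ⊢
      rw [hf2, he2, h1]
    · rw [← hx]
      simp only [mul_assoc]
      rw [he2, hf2, h2a]
  have h4 : x * x = x := by
    calc x * x = (f * x * e) * (f * x * e) := by rw [h3]
      _ = f * (x * (e * (f * (x * e)))) := by simp only [mul_assoc]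
      _ = f * x * e := by rw [h2a, mul_assoc]
      _ = x := h3
  have h5 : e * f = dag x := dag_unique x _ h2 h1
  have h6 : e * f = x := by rw [h5, dag_idem h4]
  rw [h6]
  exact h4

lemma idem_comm {e f : S} (he : IsIdempotentElem e) (hf : IsIdempotentElem f) :
    e * f = f * e := by
  have he2 : ∀ z, e * (e * z) = e * z := fun z => by rw [← mul_assoc, he.eq]
  have hf2 : ∀ z, f * (f * z) = f * z := fun z => by rw [← mul_assoc, hf.eq]
  have hef := isIdem_mul he hf
  have hfe := isIdem_mul hf he
  have : f * e = dag (e * f) := by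
    refine dag_unique _ _ ?_ ?_
    · have := hef.eq
      simp only [mul_assoc] at this ⊢
      rw [hf2, he2, this]
    · have := hfe.eq
      simp only [mul_assoc] at this ⊢
      rw [he2, hf2, this]
  rw [this, dag_idem hef]

lemma dag_mul (a b : S) : dag (a * b) = dag b * dag a := by
  have h : ∀ c d z : S, c * (dag c * (d * (dag d * z))) = d * (dag d * (c * (dag c * z))) := by
    intro c d z
    have := congrArg (· * z) (idem_comm (isIdem_mul_dag c) (isIdem_mul_dag d))
    simpa only [mul_assoc] using this
  have ha : ∀ c z : S, c * (dag c * (c * z)) = c * z := fun c z => by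
    have := congrArg (· * z) (mul_dag_mul c)
    simpa only [mul_assoc] using this
  have hc : (dag a * a) * (b * dag b) = (b * dag b) * (dag a * a) :=
    idem_comm (isIdem_dag_mul a) (isIdem_mul_dag b)
  refine (dag_unique _ _ ?_ ?_).symm
  · calc a * b * (dag b * dag a) * (a * b) = a * ((b * dag b) * (dag a * a)) * b := by
          simp only [mul_assoc]
      _ = (a * dag a * a) * (b * dag b * b) := by rw [← hc]; simp only [mul_assoc]
      _ = a * b := by rw [mul_dag_mul, mul_dag_mul]
  · calc dag b * dag a * (a * b) * (dag b * dag a)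
          = dag b * ((dag a * a) * (b * dag b)) * dag a := by simp only [mul_assoc]
      _ = (dag b * b * dag b) * (dag a * a * dag a) := by rw [hc]; simp only [mul_assoc]
      _ = dag b * dag a := by rw [dag_mul_dag, dag_mul_dag]

lemma isIdem_conj {e : S} (he : IsIdempotentElem e) (r : S) :
    IsIdempotentElem (dag r * e * r) := by
  have hc : (r * dag r) * e = e * (r * dag r) := idem_comm (isIdem_mul_dag r) he
  unfold IsIdempotentElem
  calc dag r * e * r * (dag r * e * r) = dag r * e * ((r * dag r) * e) * r := by
        simp only [mul_assoc]
    _ = dag r * (e * e) * (r * dag r * r) := by rw [hc]; simp only [mul_assoc]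
    _ = dag r * e * r := by rw [he.eq, mul_dag_mul]

lemma natLE_mul_left {s t : S} (h : NatLE s t) (r : S) : NatLE (r * s) (r * t) := by
  obtain ⟨e, he, rfl⟩ := h
  exact ⟨e, he, by rw [mul_assoc]⟩

lemma natLE_mul_right {s t : S} (h : NatLE s t) (r : S) : NatLE (s * r) (t * r) := by
  obtain ⟨e, he, rfl⟩ := h
  refine ⟨dag r * e * r, isIdem_conj he r, ?_⟩
  have hc : (r * dag r) * e = e * (r * dag r) := idem_comm (isIdem_mul_dag r) he
  calc t * e * r = t * e * (r * dag r * r) := by rw [mul_dag_mul]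
    _ = t * (e * (r * dag r)) * r := by simp only [mul_assoc]
    _ = t * r * (dag r * e * r) := by rw [← hc]; simp only [mul_assoc]

lemma natLE_dag {s t : S} (h : NatLE s t) : NatLE (dag s) (dag t) := by
  obtain ⟨e, he, rfl⟩ := h
  rw [dag_mul, dag_idem he]
  refine ⟨t * e * dag t, ?_, ?_⟩
  · have := isIdem_conj he (dag t)
    rwa [dag_dag] at this
  · have hc : (dag t * t) * e = e * (dag t * t) := idem_comm (isIdem_dag_mul t) he
    calc e * dag t = e * (dag t * t * dag t) := by rw [dag_mul_dag]
      _ = (e * (dag t * t)) * dag t := by simp only [mul_assoc]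
      _ = dag t * (t * e * dag t) := by rw [← hc]; simp only [mul_assoc]

end basic

end InverseSemigroup

open InverseSemigroup

/-- A Boolean inverse monoid: an inverse monoid with `0` whose idempotents form a Boolean algebra
in the natural partial order, which is a meet semilattice in that order, and in which any two
orthogonal elements have a join. The partial order, the meet and the Boolean algebra structure
are determined by the multiplication. -/
class BooleanInverseMonoid (S : Type u)
    extends InverseSemigroup S, MonoidWithZero S, SemilatticeInf S where
  le_iff_natLE : ∀ s t : S, s ≤ t ↔ NatLE s t
  idemBoolean : BooleanAlgebra (Idem S)
  idem_le_iff : ∀ e f : Idem S, e ≤ f ↔ e.val ≤ f.val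
  exists_join : ∀ s t : S, dag s * t = 0 → t * dag s = 0 → ∃ x : S, IsLUB {s, t} x

namespace BooleanInverseMonoid

attribute [reducible, instance] BooleanInverseMonoid.idemBoolean

variable {S : Type u} [BooleanInverseMonoid S]

lemma isIdem_of_le_one {s : S} (h : s ≤ 1) : IsIdempotentElem s := by
  obtain ⟨e, he, rfl⟩ := (le_iff_natLE _ _).1 h
  rwa [one_mul]

lemma mul_le_mul_of_le {a b c d : S} (h : a ≤ b) (h2 : c ≤ d) : a * c ≤ b * d :=
  ((le_iff_natLE _ _).2 (natLE_mul_right ((le_iff_natLE _ _).1 h) c)).trans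
    ((le_iff_natLE _ _).2 (natLE_mul_left ((le_iff_natLE _ _).1 h2) b))

lemma le_one_of_idem {e : S} (he : IsIdempotentElem e) : e ≤ 1 :=
  (le_iff_natLE _ _).2 ⟨e, he, (one_mul e).symm⟩

/-- The fixed point idempotent `s† t ∧ 1` is symmetric in `s` and `t`. -/
lemma fix_symm (s t : S) : dag s * t ⊓ 1 = dag t * s ⊓ 1 := by
  have key : ∀ a b : S, dag a * b ⊓ 1 ≤ dag b * a ⊓ 1 := by
    intro a b
    have h1 : IsIdempotentElem (dag a * b ⊓ 1) := isIdem_of_le_one inf_le_right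
    refine le_inf ?_ inf_le_right
    have h2 := natLE_dag ((le_iff_natLE _ _).1 (inf_le_left : dag a * b ⊓ 1 ≤ dag a * b))
    rw [dag_idem h1, dag_mul, dag_dag] at h2
    exact (le_iff_natLE _ _).2 h2
  exact le_antisymm (key s t) (key t s)

/-- Transitivity of the fixed point idempotents. -/
lemma fix_trans (r s t : S) : (dag r * s ⊓ 1) * (dag s * t ⊓ 1) ≤ dag r * t ⊓ 1 := by
  refine le_inf ?_ ?_
  · refine (mul_le_mul_of_le inf_le_left inf_le_left).trans ?_
    calc dag r * s * (dag s * t) = dag r * (s * dag s) * t := by simp only [mul_assoc]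
      _ ≤ dag r * 1 * t :=
        mul_le_mul_of_le (mul_le_mul_of_le le_rfl (le_one_of_idem (isIdem_mul_dag s))) le_rfl
      _ = dag r * t := by rw [mul_one]
  · calc _ ≤ (1 : S) * 1 := mul_le_mul_of_le inf_le_right inf_le_right
      _ = 1 := one_mul 1

end BooleanInverseMonoid

/-- The character space of a Boolean algebra: its (unital) lattice homomorphisms into the
two-element lattice. -/
structure CharacterSpace (L : Type u) [BooleanAlgebra L] where
  hom : BoundedLatticeHom L Bool

namespace CharacterSpace

variable {L : Type u} [BooleanAlgebra L]

/-- The set `G_e` of the characters supported on `e`. -/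
def basic (e : L) : Set (CharacterSpace L) := {ρ | ρ.hom e = true}

/-- The Stone topology, generated by the sets `G_e`. -/
instance : TopologicalSpace (CharacterSpace L) :=
  TopologicalSpace.generateFrom (Set.range (basic (L := L)))

lemma isInducing_hom :
    Topology.IsInducing (fun (ρ : CharacterSpace L) (e : L) => ρ.hom e) := by
  refine ⟨le_antisymm ?_ ?_⟩
  · rw [← continuous_iff_le_induced]
    refine continuous_pi fun e => ?_
    rw [continuous_discrete_rng]
    have h : ∀ e : L, IsOpen (basic e) := fun e =>
      TopologicalSpace.isOpen_generateFrom_of_mem ⟨e, rfl⟩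
    intro b
    cases b with
    | true => exact h e
    | false =>
      have : ((fun ρ : CharacterSpace L => ρ.hom e) ⁻¹' {false}) = basic eᶜ := by
        ext ρ
        have h1 : ρ.hom eᶜ = (ρ.hom e)ᶜ := map_compl' _ _
        change ρ.hom e = false ↔ ρ.hom eᶜ = true
        rw [h1]
        cases ρ.hom e <;> decide
      rw [this]
      exact h _
  · refine le_generateFrom ?_
    rintro _ ⟨e, rfl⟩
    refine ⟨{f : L → Bool | f e = true}, ?_, rfl⟩
    exact (isOpen_discrete ({true} : Set Bool)).preimage
      (continuous_apply (A := fun _ : L => Bool) e)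

instance : CompactSpace (CharacterSpace L) := by
  have hcl : IsClosed (Set.range (fun (ρ : CharacterSpace L) (e : L) => ρ.hom e)) := by
    have : Set.range (fun (ρ : CharacterSpace L) (e : L) => ρ.hom e) =
        {f | f ⊤ = ⊤} ∩ {f | f ⊥ = ⊥} ∩ (⋂ a, ⋂ b, {f | f (a ⊔ b) = f a ⊔ f b}) ∩
          (⋂ a, ⋂ b, {f | f (a ⊓ b) = f a ⊓ f b}) := by
      ext f
      constructor
      · rintro ⟨ρ, rfl⟩
        refine ⟨⟨⟨map_top ρ.hom, map_bot ρ.hom⟩, ?_⟩, ?_⟩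
        · exact Set.mem_iInter₂.2 fun a b => map_sup ρ.hom a b
        · exact Set.mem_iInter₂.2 fun a b => map_inf ρ.hom a b
      · rintro ⟨⟨⟨h1, h2⟩, h3⟩, h4⟩
        exact ⟨⟨⟨⟨⟨f, fun a b => Set.mem_iInter₂.1 h3 a b⟩,
          fun a b => Set.mem_iInter₂.1 h4 a b⟩, h1, h2⟩⟩, rfl⟩
    rw [this]
    have hc : ∀ a : L, Continuous fun f : L → Bool => f a := fun a => continuous_apply a
    have h2 : ∀ (g : Bool × Bool → Bool) (a b : L),
        Continuous fun f : L → Bool => g (f a, f b) := fun g a b =>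
      (continuous_of_discreteTopology (f := g)).comp ((hc a).prodMk (hc b))
    refine IsClosed.inter (IsClosed.inter (IsClosed.inter ?_ ?_) ?_) ?_
    · exact isClosed_eq (hc _) continuous_const
    · exact isClosed_eq (hc _) continuous_const
    · exact isClosed_iInter fun a => isClosed_iInter fun b =>
        isClosed_eq (hc _) (h2 (fun p => p.1 ⊔ p.2) a b)
    · exact isClosed_iInter fun a => isClosed_iInter fun b =>
        isClosed_eq (hc _) (h2 (fun p => p.1 ⊓ p.2) a b)
  rw [← isCompact_univ_iff, isInducing_hom.isCompact_iff, Set.image_univ]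
  exact hcl.isCompact

end CharacterSpace

/-- The C⋆-algebra `D = C(X)` of a Boolean inverse monoid, `X` the character space of its
Boolean algebra of idempotents. -/
abbrev DAlg (S : Type u) [BooleanInverseMonoid S] : Type u := C(CharacterSpace (Idem S), ℂ)

/-- The semigroup of partial isometries of a commutative star ring. -/
def partialIsometries (A : Type u) [CommSemiring A] [StarRing A] : Subsemigroup A where
  carrier := {p | p * star p * p = p}
  mul_mem' := by
    intro a b ha hb
    change _ = _ at ha hb
    change _ = _
    calc a * b * star (a * b) * (a * b) = (a * star a * a) * (b * star b * b) := by
          rw [star_mul]; ring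
      _ = a * b := by rw [ha, hb]

/-- An (idempotent separating) extension `P ↪ G → S` of the inverse semigroup `S` by `P`, where
`π = q ∘ ι : P → S` takes values in the idempotents of `S` and restricts to an isomorphism of the
idempotents of `P` onto the idempotents of `S`. -/
structure InvExtension (P : Type*) (G : Type*) (S : Type*) [Semigroup P] [InverseSemigroup G]
    [InverseSemigroup S] where
  ι : P →ₙ* G
  q : G →ₙ* S
  ι_injective : Function.Injective ι
  q_surjective : Function.Surjective q
  isIdem_q_iff : ∀ g : G, IsIdempotentElem (q g) ↔ ∃ p : P, ι p = g
  bijOn_idem : Set.BijOn (fun p => q (ι p)) {p | IsIdempotentElem p} {e | IsIdempotentElem e}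

/-- An extension of a Boolean inverse monoid `S` by the partial isometries of `D`. -/
abbrev BooleanExtension (S : Type u) [BooleanInverseMonoid S] (G : Type v) [InverseSemigroup G] :=
  InvExtension (partialIsometries (DAlg S)) G S

/-- An order preserving section `j` of the quotient map `q`; the middle condition is `j(1) = 1`,
stated as: `j(1)` is an identity element of `G`. -/
structure OrderPreservingSection {S : Type u} [BooleanInverseMonoid S] {G : Type v}
    [InverseSemigroup G] (X : BooleanExtension S G) where
  j : S → G
  q_j : ∀ s, X.q (j s) = s
  j_one : ∀ g : G, j 1 * g = g ∧ g * j 1 = g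
  j_mono : ∀ s t : S, s ≤ t → NatLE (j s) (j t)

/-- An element of `G` lying over an idempotent of `S`, regarded as a partial isometry of `D`
through the inclusion `ι`. -/
noncomputable def InvExtension.pull {P G S : Type*} [Semigroup P] [InverseSemigroup G]
    [InverseSemigroup S] (X : InvExtension P G S) (g : G) (hg : IsIdempotentElem (X.q g)) : P :=
  ((X.isIdem_q_iff g).1 hg).choose

lemma InvExtension.ι_pull {P G S : Type*} [Semigroup P] [InverseSemigroup G]
    [InverseSemigroup S] (X : InvExtension P G S) (g : G) (hg : IsIdempotentElem (X.q g)) :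
    X.ι (X.pull g hg) = g :=
  ((X.isIdem_q_iff g).1 hg).choose_spec

lemma InvExtension.q_dag {P G S : Type*} [Semigroup P] [InverseSemigroup G]
    [InverseSemigroup S] (X : InvExtension P G S) (g : G) : X.q (dag g) = dag (X.q g) := by
  refine dag_unique _ _ ?_ ?_
  · rw [← map_mul, ← map_mul, mul_dag_mul]
  · rw [← map_mul, ← map_mul, dag_mul_dag]

/-- A positive `C(X)`-valued kernel on a set `S`. -/
structure PositiveKernel (S : Type u) (X : Type v) [TopologicalSpace X] where
  K : S → S → C(X, ℂ)
  star_K : ∀ s t, star (K s t) = K t s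
  nonneg : ∀ (n : ℕ) (c : Fin n → ℂ) (s : Fin n → S),
    0 ≤ ∑ i, ∑ l, (star (c i) * c l) • K (s i) (s l)

namespace PositiveKernel

variable {S : Type u} {X : Type v} [TopologicalSpace X]

/-- The column function `k_s(t) = K(t, s)`. -/
def col (κ : PositiveKernel S X) (s : S) : S → C(X, ℂ) := fun t => κ.K t s

/-- The `C(X)`-module of functions `S → C(X)` spanned by the columns `k_s`. The algebra is
commutative, so the right action `(u h)(s) = u(s) h` is written on the left. -/
def Pre (κ : PositiveKernel S X) : Type (max u v) :=
  Submodule.span C(X, ℂ) (Set.range κ.col)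

variable (κ : PositiveKernel S X)

noncomputable instance : AddCommGroup κ.Pre :=
  inferInstanceAs (AddCommGroup (Submodule.span C(X, ℂ) (Set.range κ.col)))

noncomputable instance : Module C(X, ℂ) κ.Pre :=
  inferInstanceAs (Module C(X, ℂ) (Submodule.span C(X, ℂ) (Set.range κ.col)))

noncomputable instance : Module ℂ κ.Pre :=
  inferInstanceAs (Module ℂ (Submodule.span C(X, ℂ) (Set.range κ.col)))

/-- The function underlying an element of the pre-module. -/
def Pre.fn {κ : PositiveKernel S X} (u : κ.Pre) : S → C(X, ℂ) := Subtype.val u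

/-- The column `k_s` as an element of the pre-module. -/
def preCol (s : S) : κ.Pre := ⟨κ.col s, Submodule.subset_span ⟨s, rfl⟩⟩

variable {κ}

lemma Pre.ext {u w : κ.Pre} (h : ∀ s, u.fn s = w.fn s) : u = w := Subtype.ext (funext h)

@[simp] lemma Pre.fn_add (u w : κ.Pre) (s : S) : (u + w).fn s = u.fn s + w.fn s := rfl
@[simp] lemma Pre.fn_smul (h : C(X, ℂ)) (u : κ.Pre) (s : S) : (h • u).fn s = h * u.fn s := rfl
@[simp] lemma Pre.fn_smulc (z : ℂ) (u : κ.Pre) (s : S) : (z • u).fn s = z • u.fn s := rfl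
@[simp] lemma Pre.fn_zero (s : S) : (0 : κ.Pre).fn s = 0 := rfl
@[simp] lemma fn_preCol (s t : S) : (κ.preCol s).fn t = κ.K t s := rfl

lemma Pre.induction {p : κ.Pre → Prop} (u : κ.Pre) (zero : p 0) (col : ∀ s, p (κ.preCol s))
    (add : ∀ a b, p a → p b → p (a + b)) (smul : ∀ (h : C(X, ℂ)) a, p a → p (h • a)) : p u :=
  Submodule.span_induction
    (p := fun f hf => p (⟨f, hf⟩ : Submodule.span C(X, ℂ) (Set.range κ.col)))
    (by rintro _ ⟨s, rfl⟩; exact col s) zero (fun _ _ _ _ h1 h2 => add _ _ h1 h2)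
    (fun c _ _ h => smul c _ h) u.2

lemma Pre.exists_rep (u : κ.Pre) :
    ∃ c : S →₀ C(X, ℂ), ∀ t, u.fn t = ∑ s ∈ c.support, c s * κ.K t s := by
  obtain ⟨c, hc⟩ := (Finsupp.mem_span_range_iff_exists_finsupp (R := C(X, ℂ))).1 u.2
  refine ⟨c, fun t => ?_⟩
  have := congrFun hc t
  change _ = u.fn t at this
  rw [← this, Finsupp.sum, Finset.sum_apply]
  rfl

/-- Coefficients `d` with `u = ∑ k_s d_s`. -/
noncomputable def Pre.rep (u : κ.Pre) : S →₀ C(X, ℂ) := u.exists_rep.choose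

lemma Pre.fn_eq (u : κ.Pre) (t : S) :
    u.fn t = ∑ s ∈ u.rep.support, u.rep s * κ.K t s := u.exists_rep.choose_spec t

/-- The inner product, conjugate linear in the first variable: for `u = ∑ k_s c_s`,
`w = ∑ k_t d_t` it is `∑ (star c_s) K(s, t) d_t` (see `Pre.ip_expand`). -/
noncomputable def Pre.ip (u w : κ.Pre) : C(X, ℂ) := ∑ s ∈ u.rep.support, star (u.rep s) * w.fn s

lemma Pre.ip_expand (u w : κ.Pre) : Pre.ip u w =
    ∑ s ∈ u.rep.support, ∑ t ∈ w.rep.support, star (u.rep s) * w.rep t * κ.K s t := by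
  rw [ip]
  refine Finset.sum_congr rfl fun s _ => ?_
  rw [w.fn_eq, Finset.mul_sum]
  simp only [mul_assoc]

lemma Pre.star_ip (u w : κ.Pre) : star (Pre.ip u w) = Pre.ip w u := by
  rw [ip_expand, ip_expand, star_sum, Finset.sum_comm]
  refine Finset.sum_congr rfl fun s _ => ?_
  rw [star_sum]
  refine Finset.sum_congr rfl fun t _ => ?_
  rw [star_mul, star_mul, star_star, κ.star_K, mul_comm]

lemma Pre.ip_preCol_left (s : S) (w : κ.Pre) : Pre.ip (κ.preCol s) w = w.fn s := by
  rw [← star_ip, ip, star_sum, w.fn_eq]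
  refine Finset.sum_congr rfl fun t _ => ?_
  rw [star_mul, star_star, fn_preCol, κ.star_K, mul_comm]

lemma Pre.ip_add_right (u w z : κ.Pre) :
    Pre.ip u (w + z) = Pre.ip u w + Pre.ip u z := by
  simp only [ip, fn_add, mul_add, Finset.sum_add_distrib]

lemma Pre.ip_smul_right (u : κ.Pre) (h : C(X, ℂ)) (w : κ.Pre) :
    Pre.ip u (h • w) = h * Pre.ip u w := by
  simp only [ip, fn_smul, Finset.mul_sum]
  refine Finset.sum_congr rfl fun t _ => ?_
  ring

lemma Pre.ip_smulc_right (u : κ.Pre) (z : ℂ) (w : κ.Pre) :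
    Pre.ip u (z • w) = z • Pre.ip u w := by
  simp only [ip, fn_smulc, Finset.smul_sum, mul_smul_comm]

lemma Pre.ip_self_nonneg (u : κ.Pre) : 0 ≤ Pre.ip u u := by
  rw [ContinuousMap.le_def]
  intro x
  have key := ContinuousMap.le_def.1 (κ.nonneg u.rep.support.card
    (fun i => u.rep (u.rep.support.equivFin.symm i) x)
    (fun i => u.rep.support.equivFin.symm i)) x
  rw [ip_expand]
  convert key using 1
  simp only [ContinuousMap.coe_sum, Finset.sum_apply, ContinuousMap.smul_apply,
    ContinuousMap.mul_apply, ContinuousMap.star_apply, smul_eq_mul]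
  rw [← Finset.sum_coe_sort, ← Equiv.sum_comp u.rep.support.equivFin.symm]
  refine Finset.sum_congr rfl fun i _ => ?_
  rw [← Finset.sum_coe_sort, ← Equiv.sum_comp u.rep.support.equivFin.symm]

/-- The scalar semi-inner product obtained by evaluating at a point of `X`. -/
@[reducible]
noncomputable def Pre.core (x : X) : PreInnerProductSpace.Core ℂ κ.Pre where
  inner u w := Pre.ip u w x
  conj_inner_symm u w := by
    rw [← star_ip w u]
    rfl
  re_inner_nonneg u :=
    (Complex.le_def.1 (ContinuousMap.le_def.1 (ip_self_nonneg u) x)).1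
  add_left u w z := by
    rw [← star_ip z, ip_add_right, star_add, star_ip, star_ip]
    rfl
  smul_left u w r := by
    rw [← star_ip w, ip_smulc_right, star_smul, star_ip]
    rfl

lemma Pre.ip_self {u : κ.Pre} : Pre.ip u u = 0 ↔ u = 0 := by
  constructor
  · intro h
    refine Pre.ext fun s => ?_
    ext x
    have key := @InnerProductSpace.Core.inner_mul_inner_self_le ℂ κ.Pre _ _ _ (Pre.core x)
      (κ.preCol s) u
    change ‖Pre.ip (κ.preCol s) u x‖ * ‖Pre.ip u (κ.preCol s) x‖ ≤
      RCLike.re (Pre.ip (κ.preCol s) (κ.preCol s) x) *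
        RCLike.re (Pre.ip u u x) at key
    rw [h, ← Pre.star_ip (κ.preCol s) u, Pre.ip_preCol_left] at key
    simp only [ContinuousMap.star_apply, norm_star, ContinuousMap.zero_apply, map_zero,
      mul_zero] at key
    have h2 : ‖u.fn s x‖ = 0 := by nlinarith [norm_nonneg (u.fn s x)]
    simpa using h2
  · rintro rfl
    simp [ip]

variable [CompactSpace X]

noncomputable instance : Norm κ.Pre where
  norm u := √‖Pre.ip u u‖

noncomputable instance : CStarModule C(X, ℂ) κ.Pre where
  inner := Pre.ip
  inner_add_right := Pre.ip_add_right _ _ _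
  inner_self_nonneg := Pre.ip_self_nonneg _
  inner_self := Pre.ip_self
  inner_op_smul_right := Pre.ip_smul_right _ _ _
  inner_smul_right_complex := Pre.ip_smulc_right _ _ _
  star_inner := Pre.star_ip
  norm_eq_sqrt_norm_inner_self _ := rfl

noncomputable instance : NormedAddCommGroup κ.Pre := CStarModule.normedAddCommGroup C(X, ℂ)

noncomputable instance : NormedSpace ℂ κ.Pre := .ofCore (CStarModule.normedSpaceCore C(X, ℂ))

instance : IsBoundedSMul C(X, ℂ) κ.Pre := by
  refine .of_norm_smul_le fun h u => ?_
  refine le_of_sq_le_sq ?_ (by positivity)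
  rw [mul_pow, CStarModule.norm_sq_eq (E := κ.Pre) C(X, ℂ),
    CStarModule.norm_sq_eq (E := κ.Pre) C(X, ℂ)]
  rw [CStarModule.inner_op_smul_left, CStarModule.inner_op_smul_right]
  refine (norm_mul_le _ _).trans ?_
  rw [norm_star]
  have := norm_mul_le h (inner C(X, ℂ) u u)
  nlinarith [norm_nonneg h]

variable (κ)

/-- The reproducing kernel Hilbert module of `κ`: the completion of the `C(X)`-span of the columns
in the norm `‖u‖ = ‖⟨u, u⟩‖ ^ (1 / 2)`. Whenever the complex span of the columns is dense in it, it
is also the completion of that complex span. -/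
noncomputable def RKModule : Type (max u v) := UniformSpace.Completion κ.Pre

noncomputable instance : NormedAddCommGroup κ.RKModule :=
  inferInstanceAs (NormedAddCommGroup (UniformSpace.Completion κ.Pre))

noncomputable instance : NormedSpace ℂ κ.RKModule :=
  inferInstanceAs (NormedSpace ℂ (UniformSpace.Completion κ.Pre))

instance : CompleteSpace κ.RKModule :=
  inferInstanceAs (CompleteSpace (UniformSpace.Completion κ.Pre))

noncomputable instance : Module C(X, ℂ) κ.RKModule :=
  inferInstanceAs (Module C(X, ℂ) (UniformSpace.Completion κ.Pre))

variable {κ}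

/-- The canonical dense embedding of the pre-module. -/
noncomputable def toRK (u : κ.Pre) : κ.RKModule := (u : UniformSpace.Completion κ.Pre)

/-- The inner product of the completion, extended by continuity. -/
noncomputable def rkip (u w : κ.RKModule) : C(X, ℂ) :=
  Inner.inner (𝕜 := C(X, ℂ)) (E := UniformSpace.Completion κ.Pre) u w

lemma continuous_preInner :
    Continuous (Function.uncurry (inner C(X, ℂ) (E := κ.Pre))) :=
  CStarModule.continuous_inner

lemma rkip_toRK (u w : κ.Pre) :
    rkip (toRK u) (toRK w) = Pre.ip u w :=
  (UniformSpace.Completion.isDenseInducing_coe.prodMap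
    UniformSpace.Completion.isDenseInducing_coe).extend_eq continuous_preInner (u, w)

lemma continuous_rkInner :
    Continuous (fun p : κ.RKModule × κ.RKModule => rkip p.1 p.2) := by
  let B : κ.Pre →+ κ.Pre →+ C(X, ℂ) :=
    { toFun := fun u => (CStarModule.innerₛₗ (A := C(X, ℂ)) u).toAddMonoidHom
      map_zero' := by ext w; simp
      map_add' := fun u w => by ext z; simp }
  have hB : Continuous fun p : κ.Pre × κ.Pre => B p.1 p.2 := continuous_preInner
  exact (UniformSpace.Completion.isDenseInducing_toCompl κ.Pre).extend_Z_bilin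
    (UniformSpace.Completion.isDenseInducing_toCompl κ.Pre) hB

lemma denseRange_toRK : DenseRange (toRK (κ := κ)) := UniformSpace.Completion.denseRange_coe

instance : ContinuousConstSMul C(X, ℂ) κ.RKModule :=
  inferInstanceAs (ContinuousConstSMul C(X, ℂ) (UniformSpace.Completion κ.Pre))

lemma toRK_add (u w : κ.Pre) : toRK u + toRK w = toRK (u + w) :=
  (UniformSpace.Completion.coe_add u w).symm

lemma toRK_smul (h : C(X, ℂ)) (u : κ.Pre) : h • toRK u = toRK (h • u) :=
  (UniformSpace.Completion.coe_smul h u).symm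

lemma toRK_smulc (z : ℂ) (u : κ.Pre) : z • toRK u = toRK (z • u) :=
  (UniformSpace.Completion.coe_smul z u).symm

lemma norm_toRK (u : κ.Pre) : ‖toRK u‖ = ‖u‖ := UniformSpace.Completion.norm_coe u

lemma rk_norm_eq (u : κ.RKModule) : ‖u‖ = √‖rkip u u‖ := by
  refine denseRange_toRK.induction_on u ?_ fun u => ?_
  · exact isClosed_eq continuous_norm
      (continuous_norm.comp (continuous_rkInner.comp (continuous_id.prodMk continuous_id))).sqrt
  · rw [norm_toRK, rkip_toRK]
    rfl

noncomputable instance : CStarModule C(X, ℂ) κ.RKModule where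
  inner := rkip
  inner_add_right {u w z} := by
    have h := continuous_rkInner (κ := κ)
    refine denseRange_toRK.induction_on₃ (p := fun u w z : κ.RKModule =>
      rkip u (w + z) = rkip u w + rkip u z) ?_ ?_ u w z
    · exact isClosed_eq
        (h.comp (continuous_fst.prodMk (continuous_snd.fst.add continuous_snd.snd)))
        ((h.comp (continuous_fst.prodMk continuous_snd.fst)).add
          (h.comp (continuous_fst.prodMk continuous_snd.snd)))
    · intro u w z
      rw [toRK_add, rkip_toRK, rkip_toRK, rkip_toRK, Pre.ip_add_right]
  inner_self_nonneg {u} := by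
    rw [ContinuousMap.le_def]
    intro x
    have h := continuous_rkInner (κ := κ)
    refine denseRange_toRK.induction_on (p := fun u : κ.RKModule =>
      (0 : ℂ) ≤ rkip u u x) u ?_ fun u => ?_
    · exact isClosed_le continuous_const
        ((continuous_eval_const x).comp (h.comp (continuous_id.prodMk continuous_id)))
    · rw [rkip_toRK]
      exact ContinuousMap.le_def.1 (Pre.ip_self_nonneg u) x
  inner_self {u} := by
    rw [← norm_eq_zero (a := u), rk_norm_eq, Real.sqrt_eq_zero (norm_nonneg _), norm_eq_zero]
  inner_op_smul_right {a u w} := by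
    have h := continuous_rkInner (κ := κ)
    refine denseRange_toRK.induction_on₂ (p := fun u w : κ.RKModule =>
      rkip u (a • w) = a * rkip u w) ?_ ?_ u w
    · exact isClosed_eq (h.comp (continuous_fst.prodMk (continuous_snd.const_smul a)))
        (continuous_const.mul h)
    · intro u w
      rw [toRK_smul, rkip_toRK, rkip_toRK, Pre.ip_smul_right]
  inner_smul_right_complex {a u w} := by
    have h := continuous_rkInner (κ := κ)
    refine denseRange_toRK.induction_on₂ (p := fun u w : κ.RKModule =>
      rkip u (a • w) = a • rkip u w) ?_ ?_ u w
    · exact isClosed_eq (h.comp (continuous_fst.prodMk (continuous_snd.const_smul a)))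
        (h.const_smul a)
    · intro u w
      rw [toRK_smulc, rkip_toRK, rkip_toRK, Pre.ip_smulc_right]
  star_inner u w := by
    have h := continuous_rkInner (κ := κ)
    refine denseRange_toRK.induction_on₂ (p := fun u w : κ.RKModule =>
      star (rkip u w) = rkip w u) ?_ ?_ u w
    · exact isClosed_eq h.star (h.comp continuous_swap)
    · intro u w
      rw [rkip_toRK, rkip_toRK, Pre.star_ip]
  norm_eq_sqrt_norm_inner_self u := rk_norm_eq u

lemma inner_toRK (u w : κ.Pre) : inner C(X, ℂ) (toRK u) (toRK w) = Pre.ip u w := rkip_toRK u w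

lemma continuous_inner_rk :
    Continuous (fun p : κ.RKModule × κ.RKModule => inner C(X, ℂ) p.1 p.2) := continuous_rkInner

variable (κ)

/-- The column function `k_s` as an element of the module. -/
noncomputable def k (s : S) : κ.RKModule := toRK (κ.preCol s)

lemma inner_k_k (s t : S) : inner C(X, ℂ) (κ.k s) (κ.k t) = κ.K s t := by
  rw [k, k, inner_toRK, Pre.ip_preCol_left, fn_preCol]

/-- The function `S → C(X)` represented by an element of the module. -/
noncomputable def eval (u : κ.RKModule) (s : S) : C(X, ℂ) := inner C(X, ℂ) (κ.k s) u

lemma eval_toRK (u : κ.Pre) (s : S) : κ.eval (toRK u) s = u.fn s := by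
  rw [eval, k, inner_toRK, Pre.ip_preCol_left]

/-- The module is a space of functions: an element is determined by its values. -/
lemma eval_injective : Function.Injective κ.eval := by
  have key : ∀ u : κ.RKModule, (∀ s, κ.eval u s = 0) → u = 0 := by
    intro u hu
    have h : ∀ w : κ.RKModule, inner C(X, ℂ) u w = 0 := by
      intro w
      refine denseRange_toRK.induction_on (p := fun w : κ.RKModule => inner C(X, ℂ) u w = 0)
        w ?_ fun w => ?_
      · exact isClosed_eq (continuous_inner_rk.comp (continuous_const.prodMk continuous_id))
          continuous_const
      · induction w using Pre.induction with
        | zero => exact CStarModule.inner_zero_right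
        | col s =>
          have := congrArg star (hu s)
          rwa [eval, CStarModule.star_inner, star_zero] at this
        | add a b h1 h2 => rw [← toRK_add, CStarModule.inner_add_right, h1, h2, add_zero]
        | smul c a h1 => rw [← toRK_smul, CStarModule.inner_op_smul_right, h1, mul_zero]
    exact CStarModule.inner_self.1 (h u)
  intro u w h
  rw [← sub_eq_zero]
  refine key _ fun s => ?_
  rw [eval, CStarModule.inner_sub_right, sub_eq_zero]
  exact congrFun h s

end PositiveKernel

namespace OrderPreservingSection

variable {S : Type u} [BooleanInverseMonoid S] {G : Type v} [InverseSemigroup G]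
  {X : BooleanExtension S G} (J : OrderPreservingSection X)

/-- For an idempotent `e` of `S`, the element `j(e)` regarded as an element of `D`. -/
noncomputable def proj (e : S) (he : IsIdempotentElem e) : DAlg S :=
  X.pull (J.j e) (by rwa [J.q_j])

lemma isIdem_j {e : S} (he : IsIdempotentElem e) : IsIdempotentElem (J.j e) := by
  obtain ⟨g, hg, h⟩ := J.j_mono e 1 (BooleanInverseMonoid.le_one_of_idem he)
  rw [h, (J.j_one g).1]
  exact hg

/-- The extension separates idempotents. -/
lemma idem_sep {g h : G} (hg : IsIdempotentElem g) (hh : IsIdempotentElem h)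
    (hq : X.q g = X.q h) : g = h := by
  have aux : ∀ {g : G}, IsIdempotentElem g → ∃ p, IsIdempotentElem p ∧ X.ι p = g := by
    intro g hg
    obtain ⟨p, rfl⟩ := (X.isIdem_q_iff g).1 (by
      have := congrArg X.q hg.eq
      rwa [map_mul] at this)
    refine ⟨p, X.ι_injective ?_, rfl⟩
    rw [map_mul]
    exact hg
  obtain ⟨p, hp, rfl⟩ := aux hg
  obtain ⟨r, hr, rfl⟩ := aux hh
  rw [X.bijOn_idem.injOn hp hr hq]

lemma proj_mul {e f : S} (he : IsIdempotentElem e) (hf : IsIdempotentElem f)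
    (hef : IsIdempotentElem (e * f)) : J.proj (e * f) hef = J.proj e he * J.proj f hf := by
  refine congrArg Subtype.val (X.ι_injective (?_ : _ = X.ι (X.pull (J.j e) _ * X.pull (J.j f) _)))
  rw [map_mul, X.ι_pull, X.ι_pull, X.ι_pull]
  refine idem_sep (X := X) (J.isIdem_j hef) (isIdem_mul (J.isIdem_j he) (J.isIdem_j hf)) ?_
  rw [map_mul, J.q_j, J.q_j, J.q_j]

lemma proj_apply {e : S} (he : IsIdempotentElem e) (x : CharacterSpace (Idem S)) :
    J.proj e he x = 0 ∨ J.proj e he x = 1 := by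
  have h : J.proj e he = J.proj e he * J.proj e he := by
    rw [← J.proj_mul he he (isIdem_mul he he)]
    congr 1
    exact he.eq.symm
  have := congrArg (fun f : DAlg S => f x) h
  simp only [ContinuousMap.mul_apply] at this
  by_cases h0 : J.proj e he x = 0
  · exact Or.inl h0
  · refine Or.inr (mul_left_cancel₀ h0 ?_)
    rw [mul_one]
    exact this.symm

/-- The kernel function `K(t, s) = j(s† t ∧ 1)`. -/
noncomputable def kernelFun (t s : S) : DAlg S :=
  J.proj (dag s * t ⊓ 1) (BooleanInverseMonoid.isIdem_of_le_one inf_le_right)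

lemma kernelFun_symm (t s : S) : J.kernelFun t s = J.kernelFun s t := by
  unfold kernelFun
  congr 1
  exact BooleanInverseMonoid.fix_symm s t

lemma kernelFun_trans (r s t : S) (x : CharacterSpace (Idem S)) (h1 : J.kernelFun r s x = 1)
    (h2 : J.kernelFun s t x = 1) : J.kernelFun r t x = 1 := by
  have hle := BooleanInverseMonoid.fix_trans t s r
  have he : IsIdempotentElem (dag t * s ⊓ 1) := BooleanInverseMonoid.isIdem_of_le_one inf_le_right
  have hf : IsIdempotentElem (dag s * r ⊓ 1) := BooleanInverseMonoid.isIdem_of_le_one inf_le_right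
  have hg : IsIdempotentElem (dag t * r ⊓ 1) := BooleanInverseMonoid.isIdem_of_le_one inf_le_right
  obtain ⟨g, hgi, hge⟩ := (BooleanInverseMonoid.le_iff_natLE _ _).1 hle
  have hef := isIdem_mul he hf
  have h3 : J.proj _ hef = J.proj _ hg * J.proj _ hef := by
    rw [← J.proj_mul hg hef (isIdem_mul hg hef)]
    congr 1
    rw [hge, ← mul_assoc, hg.eq]
  rw [J.proj_mul he hf hef] at h3
  have := congrArg (fun f : DAlg S => f x) h3
  simp only [ContinuousMap.mul_apply] at this
  change J.kernelFun s t x * J.kernelFun r s x =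
    J.kernelFun r t x * (J.kernelFun s t x * J.kernelFun r s x) at this
  rw [h1, h2] at this
  simpa using this.symm

/-- A partial equivalence relation defines a positive semidefinite matrix. -/
lemma per_nonneg {n : ℕ} (R : Fin n → Fin n → Prop) (hs : ∀ i l, R i l → R l i)
    (ht : ∀ i l m, R i l → R l m → R i m) (c : Fin n → ℂ) (a : Fin n → Fin n → ℂ)
    (h0 : ∀ i l, ¬ R i l → a i l = 0) (h1 : ∀ i l, R i l → a i l = 1) :
    0 ≤ ∑ i, ∑ l, star (c i) * c l * a i l := by
  classical
  let F : Fin n → Finset (Fin n) := fun i => Finset.univ.filter (R i)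
  let d : Finset (Fin n) → Fin n → ℂ := fun A i => if R i i ∧ F i = A then c i else 0
  have key : ∑ i, ∑ l, star (c i) * c l * a i l = ∑ A, star (∑ i, d A i) * ∑ l, d A l := by
    have h : ∀ i l, star (c i) * c l * a i l = ∑ A, star (d A i) * d A l := by
      intro i l
      by_cases hil : R i l
      · have hii := ht _ _ _ hil (hs _ _ hil)
        have hll := ht _ _ _ (hs _ _ hil) hil
        have hF : F l = F i := by
          ext m
          simp only [F, Finset.mem_filter, Finset.mem_univ, true_and]
          exact ⟨fun h => ht _ _ _ hil h, fun h => ht _ _ _ (hs _ _ hil) h⟩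
        rw [Finset.sum_eq_single (F i)]
        · simp [d, hii, hll, hF, h1 _ _ hil]
        · intro A _ hA
          simp [d, Ne.symm hA]
        · simp
      · rw [h0 _ _ hil, mul_zero]
        refine (Finset.sum_eq_zero fun A _ => ?_).symm
        by_cases hi : R i i ∧ F i = A
        · by_cases hl : R l l ∧ F l = A
          · exfalso
            have : l ∈ F l := by simp [F, hl.1]
            rw [hl.2, ← hi.2] at this
            exact hil (by simpa [F] using this)
          · simp [d, hl]
        · simp [d, hi]
    simp only [h, star_sum, Finset.sum_mul_sum]
    rw [Finset.sum_comm]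
    simp only [Finset.sum_comm (t := (Finset.univ : Finset (Finset (Fin n))))]
    refine Finset.sum_congr rfl fun A _ => ?_
    rw [Finset.sum_comm]
  rw [key]
  exact Finset.sum_nonneg fun A _ => star_mul_self_nonneg _

/-- The positive `D`-valued kernel `K(t, s) = j(s† t ∧ 1)` on `S`. -/
noncomputable def kernel : PositiveKernel S (CharacterSpace (Idem S)) where
  K := J.kernelFun
  star_K s t := by
    rw [J.kernelFun_symm t s]
    ext x
    rw [ContinuousMap.star_apply]
    rcases J.proj_apply (BooleanInverseMonoid.isIdem_of_le_one
      (inf_le_right : dag t * s ⊓ 1 ≤ 1)) x with h | h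
    · change J.kernelFun s t x = 0 at h
      rw [h, star_zero]
    · change J.kernelFun s t x = 1 at h
      rw [h, star_one]
  nonneg n c s := by
    rw [ContinuousMap.le_def]
    intro x
    simp only [ContinuousMap.coe_sum, Finset.sum_apply, ContinuousMap.smul_apply, smul_eq_mul]
    refine per_nonneg (fun i l => J.kernelFun (s i) (s l) x = 1) ?_ ?_ c _ ?_ fun i l h => h
    · intro i l h
      rwa [J.kernelFun_symm]
    · exact fun i l m h h2 => J.kernelFun_trans _ _ _ x h h2
    · intro i l h
      exact (J.proj_apply _ x).resolve_right h

/-- The right Hilbert `D`-module `𝔄` with reproducing kernel `K`. -/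
noncomputable abbrev hilbertModule : Type u := J.kernel.RKModule

/-- The cocycle-like function `σ(v, s) = j(q(v) s)† v j(s)`, as an element of `D`. -/
noncomputable def sigma (v : G) (s : S) : DAlg S :=
  X.pull (dag (J.j (X.q v * s)) * v * J.j s) (by
    rw [map_mul, map_mul, X.q_dag, J.q_j, J.q_j, mul_assoc]
    exact isIdem_dag_mul _)

end OrderPreservingSection

section Adjointable

variable (A E : Type*) [CStarAlgebra A] [PartialOrder A] [SMul A E] [NormedAddCommGroup E]
  [NormedSpace ℂ E] [CStarModule A E]

/-- `T'` is an adjoint of the operator `T` for the `A`-valued inner product. -/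
def IsAdjointOf (T' T : E →L[ℂ] E) : Prop :=
  ∀ x y : E, inner A (T x) y = inner A x (T' y)

/-- The algebra `L(E)` of adjointable operators on the Hilbert module `E`. -/
def adjointableOperators : Subalgebra ℂ (E →L[ℂ] E) where
  carrier := {T | ∃ T', IsAdjointOf A E T' T}
  mul_mem' := by
    rintro T R ⟨T', hT⟩ ⟨R', hR⟩
    exact ⟨R' * T', fun x y => (hT _ _).trans (hR _ _)⟩
  add_mem' := by
    rintro T R ⟨T', hT⟩ ⟨R', hR⟩
    refine ⟨T' + R', fun x y => ?_⟩
    simp [hT x y, hR x y]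
  algebraMap_mem' := by
    intro z
    refine ⟨algebraMap ℂ _ (star z), fun x y => ?_⟩
    simp [Algebra.algebraMap_eq_smul_one]

/-- An adjointable operator `T` is a partial isometry if `T T* T = T`. -/
def IsPartialIsometryOp (T : adjointableOperators A E) : Prop :=
  ∃ T' : adjointableOperators A E, IsAdjointOf A E T'.1 T.1 ∧ T * T' * T = T

end Adjointable

/-!
The operator `λ(v)` is the restriction of the operator on all functions `S → D` which sends `u` to
`t ↦ σ(v†, t)* u(q(v†) t)`. The identity `σ(v, s) K(t, q(v) s) = σ(v†, t)* K(q(v†) t, s)` says both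
that this operator maps `k_s` to `k_{q(v) s} σ(v, s)` and that the operators of `v` and `v†` are
adjoint to each other. Since `σ(v w, s) = σ(v, q(w) s) σ(w, s)`, the operators are multiplicative in
`v`, hence partial isometries; so they are contractive and extend to the completion.

The complex span of the columns is dense because `k_s j(e) = k_{s e}` for an idempotent `e`, and the
elements `j(e)` are the indicator functions of the basic clopen sets, which span a dense subspace of
`D`. The representation is faithful because the values `σ(v, s) K(t, q(v) s)` of `λ(v) k_s`
determine the kernel `K(t, q(v) s) = |σ(v, s) K(t, q(v) s)|²`, hence `q(v)`, and then `σ(v, 1)`,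
hence `v`.
-/

namespace InverseSemigroup

variable {S T : Type*} [InverseSemigroup S] [InverseSemigroup T]

lemma map_dag {F : Type*} [FunLike F S T] [MulHomClass F S T] (f : F) (s : S) :
    f (dag s) = dag (f s) := by
  refine dag_unique _ _ ?_ ?_
  · rw [← map_mul, ← map_mul, mul_dag_mul]
  · rw [← map_mul, ← map_mul, dag_mul_dag]

lemma mul_dag_mul_eq_of_natLE {s t : S} (h : NatLE s t) : t * (dag s * s) = s := by
  obtain ⟨e, he, rfl⟩ := h
  calc t * (dag (t * e) * (t * e)) = t * (e * (dag t * t)) * e := by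
        rw [dag_mul, dag_idem he]
        simp only [mul_assoc]
    _ = t * e := by
        rw [idem_comm he (isIdem_dag_mul t), ← mul_assoc, ← mul_assoc, mul_dag_mul, mul_assoc,
          he.eq]

lemma mul_eq_right_of_natLE {e s : S} (he : IsIdempotentElem e) (h : NatLE e s) : s * e = e := by
  simpa only [dag_idem he, he.eq] using mul_dag_mul_eq_of_natLE h

lemma mul_eq_of_natLE_mul {e s t : S} (he : IsIdempotentElem e) (h : NatLE t (e * s)) :
    e * t = t := by
  obtain ⟨f, -, rfl⟩ := h
  rw [← mul_assoc, ← mul_assoc, he.eq]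

lemma eq_of_natLE_of_map_eq {F : Type*} [FunLike F S T] [MulHomClass F S T] {f : F}
    (hf : Set.InjOn f {e | IsIdempotentElem e}) {s t r : S} (hs : NatLE s r) (ht : NatLE t r)
    (h : f s = f t) : s = t := by
  have hdom : dag s * s = dag t * t :=
    hf (isIdem_dag_mul s) (isIdem_dag_mul t) (by rw [map_mul, map_mul, map_dag, map_dag, h])
  rw [← mul_dag_mul_eq_of_natLE hs, hdom, mul_dag_mul_eq_of_natLE ht]

end InverseSemigroup

namespace BooleanInverseMonoid

variable {S : Type u} [BooleanInverseMonoid S]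

lemma mul_fix (s t : S) : s * (dag s * t ⊓ 1) = t * (dag s * t ⊓ 1) := by
  have key : ∀ a b : S, a * (dag a * b ⊓ 1) ≤ b * (dag a * b ⊓ 1) := fun a b => by
    have hfix : dag a * b * (dag a * b ⊓ 1) = dag a * b ⊓ 1 :=
      mul_eq_right_of_natLE (isIdem_of_le_one inf_le_right) ((le_iff_natLE _ _).1 inf_le_left)
    calc a * (dag a * b ⊓ 1) = (a * dag a) * (b * (dag a * b ⊓ 1)) := by
          rw [← mul_assoc, mul_assoc a, mul_assoc a, hfix]
      _ ≤ 1 * (b * (dag a * b ⊓ 1)) :=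
          mul_le_mul_of_le (le_one_of_idem (isIdem_mul_dag a)) le_rfl
      _ = b * (dag a * b ⊓ 1) := one_mul _
  refine le_antisymm (key s t) ?_
  rw [fix_symm]
  exact key t s

lemma idem_mul_inf_one {e : S} (he : IsIdempotentElem e) (s : S) :
    e * s ⊓ 1 = e * (s ⊓ 1) := by
  have he1 : e ≤ 1 := le_one_of_idem he
  refine le_antisymm ?_ (le_inf (mul_le_mul_of_le le_rfl inf_le_left) ?_)
  · rw [← mul_eq_of_natLE_mul he ((le_iff_natLE _ _).1 (inf_le_left : e * s ⊓ 1 ≤ e * s))]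
    refine mul_le_mul_of_le le_rfl (inf_le_inf_right 1 ?_)
    simpa only [one_mul] using mul_le_mul_of_le he1 (le_refl s)
  · simpa only [one_mul] using mul_le_mul_of_le he1 (inf_le_right : s ⊓ 1 ≤ 1)

lemma dag_mul_self_inf_one (s : S) : dag s * s ⊓ 1 = dag s * s :=
  inf_eq_left.2 (le_one_of_idem (isIdem_dag_mul s))

lemma le_of_dag_mul_self_eq {s t : S} (h : dag s * s = dag t * s ⊓ 1) : s ≤ t := by
  refine (le_iff_natLE _ _).2 ⟨dag t * s ⊓ 1, isIdem_of_le_one inf_le_right, ?_⟩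
  rw [mul_fix, ← h, ← mul_assoc, mul_dag_mul]

end BooleanInverseMonoid

section PartialIsometries

variable {A : Type*} [CommSemiring A] [StarRing A]

lemma star_mem_partialIsometries {p : A} (hp : p ∈ partialIsometries A) :
    star p ∈ partialIsometries A := by
  change p * star p * p = p at hp
  change star p * star (star p) * star p = star p
  simpa only [star_mul, mul_assoc] using congrArg star hp

lemma mem_partialIsometries_of_isStarProjection {p : A} (hp : IsStarProjection p) :
    p ∈ partialIsometries A := by
  change p * star p * p = p
  rw [hp.isSelfAdjoint.star_eq, hp.isIdempotentElem.eq, hp.isIdempotentElem.eq]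

end PartialIsometries

namespace InvExtension

variable {A : Type*} [CommSemiring A] [StarRing A] {G S : Type*} [InverseSemigroup G]
  [InverseSemigroup S] (X : InvExtension (partialIsometries A) G S)

/-- The element `d` of `A` is the partial isometry identified with `g` by the inclusion `ι`. -/
def Represents (d : A) (g : G) : Prop :=
  ∃ p : partialIsometries A, p.1 = d ∧ X.ι p = g

lemma represents_pull {g : G} (hg : IsIdempotentElem (X.q g)) :
    X.Represents (X.pull g hg).1 g :=
  ⟨X.pull g hg, rfl, X.ι_pull g hg⟩

variable {X}

lemma Represents.mul {c d : A} {g h : G} (hc : X.Represents c g) (hd : X.Represents d h) :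
    X.Represents (c * d) (g * h) := by
  obtain ⟨p, rfl, rfl⟩ := hc
  obtain ⟨r, rfl, rfl⟩ := hd
  exact ⟨p * r, rfl, map_mul X.ι p r⟩

lemma Represents.star {d : A} {g : G} (hd : X.Represents d g) :
    X.Represents (star d) (dag g) := by
  obtain ⟨p, rfl, rfl⟩ := hd
  have hs := star_mem_partialIsometries p.2
  refine ⟨⟨_, hs⟩, rfl, dag_unique _ _ ?_ ?_⟩
  · rw [← map_mul, ← map_mul]
    exact congrArg X.ι (Subtype.ext p.2)
  · rw [← map_mul, ← map_mul]
    refine congrArg X.ι (Subtype.ext ?_)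
    change Star.star p.1 * Star.star (Star.star p.1) * Star.star p.1 = Star.star p.1 at hs
    rwa [star_star] at hs

lemma Represents.unique {c d : A} {g : G} (hc : X.Represents c g) (hd : X.Represents d g) :
    c = d := by
  obtain ⟨p, rfl, rfl⟩ := hc
  obtain ⟨r, rfl, hr⟩ := hd
  rw [X.ι_injective hr]

lemma Represents.unique_right {d : A} {g h : G} (hg : X.Represents d g)
    (hh : X.Represents d h) : g = h := by
  obtain ⟨p, rfl, rfl⟩ := hg
  obtain ⟨r, hr, rfl⟩ := hh
  rw [Subtype.ext hr]

end InvExtension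

namespace OrderPreservingSection

open BooleanInverseMonoid

variable {S : Type u} [BooleanInverseMonoid S] {G : Type v} [InverseSemigroup G]
  {X : BooleanExtension S G} (J : OrderPreservingSection X)

lemma j_mul_idem (s : S) {e : S} (he : IsIdempotentElem e) : J.j (s * e) = J.j s * J.j e := by
  refine eq_of_natLE_of_map_eq (f := X.q) (fun _ hg _ hh => idem_sep hg hh)
    (J.j_mono _ _ ((le_iff_natLE _ _).2 ⟨e, he, rfl⟩)) ⟨_, J.isIdem_j he, rfl⟩ ?_
  rw [map_mul, J.q_j, J.q_j, J.q_j]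

lemma j_q_mul_dag (g : G) : J.j (X.q g) * dag (J.j (X.q g)) = g * dag g :=
  idem_sep (X := X) (isIdem_mul_dag _) (isIdem_mul_dag _) (by
    rw [map_mul, map_mul, X.q_dag, X.q_dag, J.q_j])

lemma represents_proj {e : S} (he : IsIdempotentElem e) :
    X.Represents (J.proj e he) (J.j e) :=
  X.represents_pull _

lemma represents_sigma (v : G) (s : S) :
    X.Represents (J.sigma v s) (dag (J.j (X.q v * s)) * v * J.j s) :=
  X.represents_pull _

lemma proj_congr {e f : S} (he : IsIdempotentElem e) (h : e = f) :
    J.proj e he = J.proj f (h ▸ he) := by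
  subst h
  rfl

lemma eq_of_proj_eq {e f : S} {he : IsIdempotentElem e} {hf : IsIdempotentElem f}
    (h : J.proj e he = J.proj f hf) : e = f := by
  have hj : J.j e = J.j f := (J.represents_proj he).unique_right (h ▸ J.represents_proj hf)
  rw [← J.q_j e, hj, J.q_j]

lemma isStarProjection_proj {e : S} (he : IsIdempotentElem e) :
    IsStarProjection (J.proj e he) where
  isIdempotentElem :=
    (J.represents_proj he).mul (J.represents_proj he) |>.unique <|
      (J.isIdem_j he).eq.symm ▸ J.represents_proj he
  isSelfAdjoint :=
    (J.represents_proj he).star.unique <| (dag_idem (J.isIdem_j he)).symm ▸ J.represents_proj he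

lemma exists_proj_eq {d : DAlg S} (hd : IsStarProjection d) :
    ∃ (e : S) (he : IsIdempotentElem e), J.proj e he = d := by
  obtain ⟨p, rfl⟩ : ∃ p : partialIsometries (DAlg S), p.1 = d :=
    ⟨⟨d, mem_partialIsometries_of_isStarProjection hd⟩, rfl⟩
  have hp : IsIdempotentElem p := Subtype.ext hd.isIdempotentElem
  have he : IsIdempotentElem (X.q (X.ι p)) := (hp.map X.ι).map X.q
  have hj : X.ι p = J.j (X.q (X.ι p)) :=
    idem_sep (X := X) (hp.map X.ι) (J.isIdem_j he) (J.q_j _).symm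
  exact ⟨_, he, (J.represents_proj he).unique ⟨p, rfl, hj⟩⟩

lemma isStarProjection_kernelFun (t s : S) : IsStarProjection (J.kernelFun t s) :=
  J.isStarProjection_proj _

lemma proj_mul_kernelFun {e : S} (he : IsIdempotentElem e) (t s : S) :
    J.proj e he * J.kernelFun t s = J.kernelFun t (s * e) := by
  have hK : IsIdempotentElem (dag s * t ⊓ 1) := isIdem_of_le_one inf_le_right
  rw [kernelFun, kernelFun, ← J.proj_mul he hK (isIdem_mul he hK)]
  refine J.proj_congr _ ?_
  rw [dag_mul, dag_idem he, mul_assoc, idem_mul_inf_one he]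

lemma kernelFun_self (s : S) : J.kernelFun s s = J.proj (dag s * s) (isIdem_dag_mul s) :=
  J.proj_congr _ (dag_mul_self_inf_one s)

lemma kernelFun_self_mul (t s : S) :
    J.kernelFun s s * J.kernelFun t s = J.kernelFun t s := by
  rw [kernelFun_self, proj_mul_kernelFun, ← mul_assoc, mul_dag_mul]

lemma kernelFun_q_mul (v : G) (t s : S) :
    J.kernelFun t (X.q v * s) = J.kernelFun (X.q (dag v) * t) s :=
  J.proj_congr _ (by rw [dag_mul, X.q_dag, mul_assoc])

lemma eq_of_kernelFun_eq {r s : S} (h : ∀ t, J.kernelFun t r = J.kernelFun t s) : r = s := by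
  have hle : ∀ {a b : S}, J.kernelFun a a = J.kernelFun a b → a ≤ b := fun {a b} hab =>
    le_of_dag_mul_self_eq ((dag_mul_self_inf_one a).symm.trans (J.eq_of_proj_eq hab))
  exact le_antisymm (hle (h r)) (hle (h s).symm)

lemma sigma_mul (a b : G) (s : S) :
    J.sigma (a * b) s = J.sigma a (X.q b * s) * J.sigma b s := by
  refine (J.represents_sigma _ _).unique ?_
  convert (J.represents_sigma a (X.q b * s)).mul (J.represents_sigma b s) using 1
  have hq : X.q b * s = X.q (b * J.j s) := by rw [map_mul, J.q_j]
  calc dag (J.j (X.q (a * b) * s)) * (a * b) * J.j s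
      = dag (J.j (X.q a * (X.q b * s))) * a * (b * J.j s) := by simp only [map_mul, mul_assoc]
    _ = dag (J.j (X.q a * (X.q b * s))) * a *
        (J.j (X.q b * s) * dag (J.j (X.q b * s)) * (b * J.j s)) := by
      rw [hq, j_q_mul_dag, mul_dag_mul]
    _ = _ := by simp only [mul_assoc]

lemma sigma_mul_proj (v : G) (s : S) {e : S} (he : IsIdempotentElem e) :
    J.sigma v s * J.proj e he = J.sigma v (s * e) := by
  have hcompress : J.sigma v (s * e) = J.proj e he * (J.sigma v s * J.proj e he) := by
    refine (J.represents_sigma _ _).unique ?_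
    convert (J.represents_proj he).mul ((J.represents_sigma v s).mul (J.represents_proj he))
      using 1
    rw [← mul_assoc (X.q v), j_mul_idem _ _ he, j_mul_idem _ _ he, dag_mul,
      dag_idem (J.isIdem_j he)]
    simp only [mul_assoc]
  rw [hcompress, mul_left_comm, (J.isStarProjection_proj he).isIdempotentElem.eq]

lemma star_sigma_dag {v : G} {s t : S} (hst : X.q v * s = t) (hts : X.q (dag v) * t = s) :
    star (J.sigma (dag v) t) = J.sigma v s := by
  refine (J.represents_sigma _ _).star.unique ?_
  convert J.represents_sigma v s using 1
  rw [hst, hts, dag_mul, dag_mul, dag_dag, dag_dag, mul_assoc]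

lemma sigma_mul_kernelFun (v : G) (s t : S) :
    J.sigma v s * J.kernelFun t (X.q v * s) =
      star (J.sigma (dag v) t) * J.kernelFun (X.q (dag v) * t) s := by
  have he : IsIdempotentElem (dag (X.q v * s) * t ⊓ 1) := isIdem_of_le_one inf_le_right
  have hstar := (J.isStarProjection_proj he).isSelfAdjoint.star_eq
  rw [← kernelFun_q_mul, kernelFun, sigma_mul_proj, ← hstar, ← star_mul, mul_comm,
    sigma_mul_proj]
  refine (J.star_sigma_dag ?_ ?_).symm
  · rw [← mul_assoc, mul_fix]
  · rw [← mul_assoc, dag_mul, ← X.q_dag, mul_assoc (dag s), ← mul_fix]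

lemma star_sigma_mul_sigma (v : G) (s : S) :
    star (J.sigma v s) * J.sigma v s = J.kernelFun (X.q v * s) (X.q v * s) := by
  have hq : X.q (dag (J.j (X.q v * s)) * v * J.j s) = dag (X.q v * s) * (X.q v * s) := by
    simp only [map_mul, X.q_dag, J.q_j, mul_assoc]
  rw [kernelFun_self]
  refine ((J.represents_sigma v s).star.mul (J.represents_sigma v s)).unique ?_
  convert J.represents_proj (isIdem_dag_mul (X.q v * s)) using 1
  refine idem_sep (X := X) (isIdem_dag_mul _) (J.isIdem_j (isIdem_dag_mul _)) ?_
  rw [map_mul, X.q_dag, hq, dag_idem (isIdem_dag_mul _), (isIdem_dag_mul _).eq, J.q_j]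

lemma sigma_mul_kernelFun_self (v : G) (s : S) :
    J.sigma v s * J.kernelFun (X.q v * s) (X.q v * s) = J.sigma v s := by
  rw [← star_sigma_mul_sigma, ← mul_assoc]
  obtain ⟨p, hp, -⟩ := J.represents_sigma v s
  rw [← hp]
  exact p.2

lemma star_mul_self_sigma_mul_kernelFun (v : G) (s t : S) :
    star (J.sigma v s * J.kernelFun t (X.q v * s)) * (J.sigma v s * J.kernelFun t (X.q v * s)) =
      J.kernelFun t (X.q v * s) := by
  have hK := J.isStarProjection_kernelFun t (X.q v * s)
  calc
    _ = (star (J.sigma v s) * J.sigma v s) *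
        (star (J.kernelFun t (X.q v * s)) * J.kernelFun t (X.q v * s)) := by
      rw [star_mul]
      ring
    _ = _ := by
      rw [star_sigma_mul_sigma, hK.isSelfAdjoint.star_eq, hK.isIdempotentElem.eq,
        kernelFun_self_mul]

lemma eq_of_sigma_one_eq {v w : G} (hq : X.q v = X.q w) (h : J.sigma v 1 = J.sigma w 1) :
    v = w := by
  have hrec : ∀ g : G, J.j (X.q g) * (dag (J.j (X.q g * 1)) * g * J.j 1) = g := fun g => by
    rw [(J.j_one _).2, mul_one, ← mul_assoc, j_q_mul_dag, mul_dag_mul]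
  rw [← hrec v, ← hrec w, (J.represents_sigma v 1).unique_right (h ▸ J.represents_sigma w 1), hq]

lemma eq_of_sigma_mul_kernelFun_eq {v w : G}
    (h : ∀ s t, J.sigma v s * J.kernelFun t (X.q v * s) =
      J.sigma w s * J.kernelFun t (X.q w * s)) : v = w := by
  have hq : X.q v = X.q w := by
    rw [← mul_one (X.q v), ← mul_one (X.q w)]
    refine J.eq_of_kernelFun_eq fun t => ?_
    rw [← star_mul_self_sigma_mul_kernelFun, h, star_mul_self_sigma_mul_kernelFun]
  refine J.eq_of_sigma_one_eq hq ?_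
  rw [← sigma_mul_kernelFun_self, h, hq, sigma_mul_kernelFun_self]

end OrderPreservingSection

section CStarModule

variable {A E F : Type*} [NonUnitalCStarAlgebra A] [PartialOrder A] [StarOrderedRing A]
  [AddCommGroup E] [Module ℂ E] [SMul A E] [Norm E] [CStarModule A E]
  [AddCommGroup F] [Module ℂ F] [SMul A F] [Norm F] [CStarModule A F]

lemma norm_apply_le_of_isPartialIsometry {T : E → F} {T' : F → E}
    (hadj : ∀ x y, inner A (T x) y = inner A x (T' y)) (h : ∀ x, T (T' (T x)) = T x) (x : E) :
    ‖T x‖ ≤ ‖x‖ := by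
  have hnorm : ‖T' (T x)‖ = ‖T x‖ := by
    rw [CStarModule.norm_eq_sqrt_norm_inner_self (A := A), ← hadj, h,
      ← CStarModule.norm_eq_sqrt_norm_inner_self (A := A)]
  have hsq : ‖T x‖ * ‖T x‖ ≤ ‖x‖ * ‖T x‖ := by
    calc ‖T x‖ * ‖T x‖ = ‖inner A x (T' (T x))‖ := by
          rw [← sq, CStarModule.norm_sq_eq A, hadj]
      _ ≤ ‖x‖ * ‖T' (T x)‖ := CStarModule.norm_inner_le E
      _ = ‖x‖ * ‖T x‖ := by rw [hnorm]
  rcases (CStarModule.norm_nonneg A (x := T x)).eq_or_lt with h0 | hpos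
  · exact h0 ▸ CStarModule.norm_nonneg A
  · exact le_of_mul_le_mul_right hsq hpos

end CStarModule

namespace PositiveKernel

variable {S : Type u} {X : Type v} [TopologicalSpace X] {κ : PositiveKernel S X}

instance : IsScalarTower ℂ C(X, ℂ) κ.Pre :=
  inferInstanceAs (IsScalarTower ℂ C(X, ℂ) (Submodule.span C(X, ℂ) (Set.range κ.col)))

lemma Pre.hom_ext {M : Type*} [AddCommMonoid M] [Module C(X, ℂ) M]
    {T R : κ.Pre →ₗ[C(X, ℂ)] M} (h : ∀ s, T (κ.preCol s) = R (κ.preCol s)) : T = R := by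
  refine LinearMap.ext fun u => ?_
  induction u using Pre.induction with
  | zero => rw [map_zero, map_zero]
  | col s => exact h s
  | add a b ha hb => rw [map_add, map_add, ha, hb]
  | smul c a ha => rw [map_smul, map_smul, ha]

variable (κ) in
/-- A self-map of `S` with coefficients, `k_s ↦ k_{toFun s} weight s`, together with data of the
same kind for the adjoint operator. The compatibility condition says that the two operators are
adjoint to each other on the columns. -/
structure WeightedShift where
  toFun : S → S
  weight : S → C(X, ℂ)
  adjFun : S → S
  adjWeight : S → C(X, ℂ)
  weight_mul_K : ∀ s t, weight s * κ.K t (toFun s) = star (adjWeight t) * κ.K (adjFun t) s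

namespace WeightedShift

variable (W : κ.WeightedShift)

/-- The weighted shift with the roles of the operator and its adjoint exchanged. -/
def adjoint : κ.WeightedShift where
  toFun := W.adjFun
  weight := W.adjWeight
  adjFun := W.toFun
  adjWeight := W.weight
  weight_mul_K s t := by
    have h := congrArg star (W.weight_mul_K t s)
    rw [star_mul, star_mul, star_star, κ.star_K, κ.star_K] at h
    rw [mul_comm, ← h, mul_comm]

/-- The operator of a weighted shift on all functions `S → C(X)`. -/
noncomputable def onFun : (S → C(X, ℂ)) →ₗ[C(X, ℂ)] (S → C(X, ℂ)) :=
  LinearMap.pi fun t => star (W.adjWeight t) • LinearMap.proj (W.adjFun t)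

lemma onFun_col (s : S) : W.onFun (κ.col s) = W.weight s • κ.col (W.toFun s) :=
  funext fun t => (W.weight_mul_K s t).symm

lemma onFun_mem_span_col {u : S → C(X, ℂ)}
    (hu : u ∈ Submodule.span C(X, ℂ) (Set.range κ.col)) :
    W.onFun u ∈ Submodule.span C(X, ℂ) (Set.range κ.col) := by
  refine (Submodule.map_span_le W.onFun _ _).2 ?_ (Submodule.mem_map_of_mem hu)
  rintro _ ⟨s, rfl⟩
  rw [onFun_col]
  exact Submodule.smul_mem _ _ (Submodule.subset_span ⟨_, rfl⟩)

/-- The operator of a weighted shift on the span of the columns. -/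
noncomputable def onPre : κ.Pre →ₗ[C(X, ℂ)] κ.Pre :=
  W.onFun.restrict fun _ => W.onFun_mem_span_col

lemma fn_onPre (u : κ.Pre) (t : S) :
    (W.onPre u).fn t = star (W.adjWeight t) * u.fn (W.adjFun t) := rfl

lemma onPre_preCol (s : S) :
    W.onPre (κ.preCol s) = W.weight s • κ.preCol (W.toFun s) :=
  Subtype.ext (W.onFun_col s)

variable [CompactSpace X]

lemma inner_onPre_left (u w : κ.Pre) :
    inner C(X, ℂ) (W.onPre u) w = inner C(X, ℂ) u (W.adjoint.onPre w) := by
  induction u using Pre.induction with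
  | zero => rw [map_zero, CStarModule.inner_zero_left, CStarModule.inner_zero_left]
  | col s =>
    rw [onPre_preCol, CStarModule.inner_op_smul_left]
    change Pre.ip _ w * star (W.weight s) = Pre.ip _ _
    rw [Pre.ip_preCol_left, Pre.ip_preCol_left, fn_onPre, mul_comm]
    rfl
  | add a b ha hb => rw [map_add, CStarModule.inner_add_left, CStarModule.inner_add_left, ha, hb]
  | smul c a ha =>
    rw [map_smul, CStarModule.inner_op_smul_left, CStarModule.inner_op_smul_left, ha]

end WeightedShift

variable [CompactSpace X]

/-- The continuous extension of an operator from the span of the columns to the Hilbert module. -/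
noncomputable def extend (T : κ.Pre →L[ℂ] κ.Pre) : κ.RKModule →L[ℂ] κ.RKModule :=
  T.completion

lemma extend_toRK (T : κ.Pre →L[ℂ] κ.Pre) (u : κ.Pre) : extend T (toRK u) = toRK (T u) :=
  ContinuousLinearMap.completion_apply_coe T u

lemma extend_mul (T R : κ.Pre →L[ℂ] κ.Pre) : extend (T * R) = extend T * extend R := by
  refine ContinuousLinearMap.ext fun u => ?_
  refine denseRange_toRK.induction_on
    (p := fun u => extend (T * R) u = extend T (extend R u)) u ?_ fun u => ?_
  · exact isClosed_eq (extend (T * R)).continuous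
      ((extend T).continuous.comp (extend R).continuous)
  · rw [extend_toRK, extend_toRK, extend_toRK]
    rfl

lemma isAdjointOf_extend {T T' : κ.Pre →L[ℂ] κ.Pre}
    (h : ∀ u w, inner C(X, ℂ) (T u) w = inner C(X, ℂ) u (T' w)) :
    IsAdjointOf C(X, ℂ) κ.RKModule (extend T') (extend T) := by
  intro u w
  refine denseRange_toRK.induction_on₂ (p := fun u w : κ.RKModule =>
    inner C(X, ℂ) (extend T u) w = inner C(X, ℂ) u (extend T' w)) ?_ ?_ u w
  · exact isClosed_eq
      (continuous_inner_rk.comp (((extend T).continuous.comp continuous_fst).prodMk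
        continuous_snd))
      (continuous_inner_rk.comp (continuous_fst.prodMk
        ((extend T').continuous.comp continuous_snd)))
  · intro u w
    rw [extend_toRK, extend_toRK, inner_toRK, inner_toRK]
    exact h u w

lemma eval_smul_k (c : C(X, ℂ)) (s t : S) : κ.eval (c • κ.k s) t = c * κ.K t s := by
  rw [eval, CStarModule.inner_op_smul_right, inner_k_k]

lemma continuous_smul_k (s : S) : Continuous fun c : C(X, ℂ) => c • κ.k s := by
  simp only [k, toRK_smul]
  exact (UniformSpace.Completion.continuous_coe _).comp (continuous_id.smul continuous_const)

lemma dense_span_k_of_smul_mem {B : Set C(X, ℂ)}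
    (hB : Dense (Submodule.span ℂ B : Set C(X, ℂ)))
    (h : ∀ b ∈ B, ∀ s, b • κ.k s ∈ Submodule.span ℂ (Set.range κ.k)) :
    Dense (Submodule.span ℂ (Set.range κ.k) : Set κ.RKModule) := by
  have hspan : ∀ s, ∀ a ∈ Submodule.span ℂ B, a • κ.k s ∈ Submodule.span ℂ (Set.range κ.k) := by
    intro s a ha
    induction ha using Submodule.span_induction with
    | mem b hb => exact h b hb s
    | zero => rw [zero_smul]; exact zero_mem _
    | add a b _ _ ha hb => rw [add_smul]; exact add_mem ha hb
    | smul z a _ ha =>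
      have hz : (z • a) • κ.k s = z • a • κ.k s := by
        simp only [k, toRK_smul, toRK_smulc, smul_assoc]
      rw [hz]
      exact Submodule.smul_mem _ z ha
  have hk : ∀ (c : C(X, ℂ)) s,
      c • κ.k s ∈ (Submodule.span ℂ (Set.range κ.k)).topologicalClosure := fun c s =>
    map_mem_closure (f := fun c : C(X, ℂ) => c • κ.k s) (continuous_smul_k s) (hB c) (hspan s)
  have hpre : ∀ (u : κ.Pre) (c : C(X, ℂ)),
      c • toRK u ∈ (Submodule.span ℂ (Set.range κ.k)).topologicalClosure := by
    intro u
    induction u using Pre.induction with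
    | zero => intro c; rw [toRK_smul, smul_zero]; exact zero_mem _
    | col s => exact fun c => hk c s
    | add a b ha hb => intro c; rw [← toRK_add, smul_add]; exact add_mem (ha c) (hb c)
    | smul d a ha => intro c; rw [← toRK_smul, smul_smul]; exact ha (c * d)
  refine dense_closure.1 (denseRange_toRK.mono ?_)
  rintro _ ⟨u, rfl⟩
  exact one_smul C(X, ℂ) (toRK u) ▸ hpre u 1

end PositiveKernel

namespace CharacterSpace

variable {L : Type u} [BooleanAlgebra L]

/-- The indicator function of the clopen set `basic e` of the characters supported on `e`. -/
noncomputable def indicator (e : L) : C(CharacterSpace L, ℂ) where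
  toFun x := bif x.hom e then 1 else 0
  continuous_toFun :=
    (continuous_of_discreteTopology (f := fun b : Bool => (bif b then 1 else 0 : ℂ))).comp
      ((continuous_apply (A := fun _ : L => Bool) e).comp isInducing_hom.continuous)

lemma indicator_apply (e : L) (x : CharacterSpace L) :
    indicator e x = bif x.hom e then 1 else 0 := rfl

lemma indicator_top : indicator (⊤ : L) = 1 := by
  ext x
  rw [indicator_apply, map_top]
  rfl

lemma indicator_inf (e f : L) : indicator (e ⊓ f) = indicator e * indicator f := by
  ext x
  rw [ContinuousMap.mul_apply, indicator_apply, indicator_apply, indicator_apply, map_inf]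
  cases x.hom e <;> cases x.hom f <;> simp

lemma isStarProjection_indicator (e : L) : IsStarProjection (indicator e) where
  isIdempotentElem := by rw [IsIdempotentElem, ← indicator_inf, inf_idem]
  isSelfAdjoint := by
    ext x
    rw [ContinuousMap.star_apply, indicator_apply]
    cases x.hom e <;> simp

lemma exists_indicator_ne {x y : CharacterSpace L} (h : x ≠ y) :
    ∃ e : L, indicator e x ≠ indicator e y := by
  by_contra! hxy
  refine h (congrArg CharacterSpace.mk (DFunLike.ext x.hom y.hom fun e => ?_))
  have he := hxy e
  rw [indicator_apply, indicator_apply] at he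
  cases hx : x.hom e <;> cases hy : y.hom e <;> simp_all

lemma dense_span_indicator :
    Dense (Submodule.span ℂ (Set.range (indicator (L := L))) : Set C(CharacterSpace L, ℂ)) := by
  let M : Submonoid C(CharacterSpace L, ℂ) :=
    { carrier := Set.range indicator
      one_mem' := ⟨⊤, indicator_top⟩
      mul_mem' := by
        rintro _ _ ⟨e, rfl⟩ ⟨f, rfl⟩
        exact ⟨e ⊓ f, indicator_inf e f⟩ }
  have hstar : star (Set.range (indicator (L := L))) ⊆ Set.range indicator := by
    rintro f ⟨e, he⟩
    exact ⟨e, by rw [← star_star f, ← he, (isStarProjection_indicator e).isSelfAdjoint.star_eq]⟩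
  have hadjoin : ((StarAlgebra.adjoin ℂ (Set.range (indicator (L := L)))) :
      Set C(CharacterSpace L, ℂ)) =
        (Submodule.span ℂ (Set.range indicator) : Submodule ℂ C(CharacterSpace L, ℂ)) := by
    rw [← StarSubalgebra.coe_toSubalgebra, StarAlgebra.adjoin_toSubalgebra,
      Set.union_eq_left.2 hstar, ← Subalgebra.coe_toSubmodule, Algebra.adjoin_eq_span]
    exact congrArg (fun N : Submonoid C(CharacterSpace L, ℂ) =>
      (Submodule.span ℂ (N : Set C(CharacterSpace L, ℂ)) : Set C(CharacterSpace L, ℂ)))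
      M.closure_eq
  have hsep : (StarAlgebra.adjoin ℂ (Set.range (indicator (L := L)))).SeparatesPoints := by
    intro x y hxy
    obtain ⟨e, he⟩ := exists_indicator_ne hxy
    exact ⟨_, ⟨indicator e, StarAlgebra.subset_adjoin ℂ _ ⟨e, rfl⟩, rfl⟩, he⟩
  have htop := ContinuousMap.starSubalgebra_topologicalClosure_eq_top_of_separatesPoints _ hsep
  rw [← hadjoin, dense_iff_closure_eq, ← StarSubalgebra.topologicalClosure_coe, htop]
  rfl

end CharacterSpace

namespace OrderPreservingSection

open PositiveKernel

variable {S : Type u} [BooleanInverseMonoid S] {G : Type v} [InverseSemigroup G]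
  {X : BooleanExtension S G} (J : OrderPreservingSection X)

lemma proj_smul_k {e : S} (he : IsIdempotentElem e) (s : S) :
    J.proj e he • J.kernel.k s = J.kernel.k (s * e) := by
  refine J.kernel.eval_injective (funext fun t => ?_)
  rw [eval_smul_k, eval, inner_k_k]
  exact J.proj_mul_kernelFun he t s

lemma dense_span_k :
    Dense (Submodule.span ℂ (Set.range J.kernel.k) : Set J.hilbertModule) := by
  refine dense_span_k_of_smul_mem CharacterSpace.dense_span_indicator ?_
  rintro _ ⟨e, rfl⟩ s
  obtain ⟨f, hf, hfe⟩ := J.exists_proj_eq (CharacterSpace.isStarProjection_indicator e)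
  rw [← hfe, J.proj_smul_k hf]
  exact Submodule.subset_span ⟨_, rfl⟩

/-- The weighted shift `k_s ↦ k_{q(v) s} σ(v, s)` of an element `v` of the extension. -/
noncomputable def shift (v : G) : J.kernel.WeightedShift where
  toFun s := X.q v * s
  weight := J.sigma v
  adjFun t := X.q (dag v) * t
  adjWeight := J.sigma (dag v)
  weight_mul_K := J.sigma_mul_kernelFun v

lemma adjoint_shift (v : G) : (J.shift v).adjoint = J.shift (dag v) := by
  simp only [shift, WeightedShift.adjoint, dag_dag]

lemma onPre_shift_mul (v w : G) :
    (J.shift (v * w)).onPre = (J.shift v).onPre ∘ₗ (J.shift w).onPre := by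
  refine Pre.hom_ext fun s => ?_
  rw [LinearMap.comp_apply, WeightedShift.onPre_preCol, WeightedShift.onPre_preCol, map_smul,
    WeightedShift.onPre_preCol, smul_smul]
  change J.sigma (v * w) s • J.kernel.preCol (X.q (v * w) * s) =
    (J.sigma w s * J.sigma v (X.q w * s)) • J.kernel.preCol (X.q v * (X.q w * s))
  rw [sigma_mul, map_mul, mul_assoc, mul_comm (J.sigma w s)]

lemma inner_onPre_shift_left (v : G) (u w : J.kernel.Pre) :
    inner (DAlg S) ((J.shift v).onPre u) w =
      inner (DAlg S) u ((J.shift (dag v)).onPre w) := by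
  rw [WeightedShift.inner_onPre_left, adjoint_shift]

lemma norm_onPre_shift_le (v : G) (u : J.kernel.Pre) : ‖(J.shift v).onPre u‖ ≤ ‖u‖ := by
  refine norm_apply_le_of_isPartialIsometry (A := DAlg S) (J.inner_onPre_shift_left v)
    (fun u => ?_) u
  rw [← LinearMap.comp_apply, ← LinearMap.comp_apply, ← onPre_shift_mul,
    ← onPre_shift_mul, mul_dag_mul]

/-- The contraction `k_s ↦ k_{q(v) s} σ(v, s)` on the span of the columns. -/
noncomputable def preOp (v : G) : J.kernel.Pre →L[ℂ] J.kernel.Pre :=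
  ((J.shift v).onPre.restrictScalars ℂ).mkContinuous 1 fun u => by
    rw [one_mul]
    exact J.norm_onPre_shift_le v u

lemma preOp_mul (v w : G) : J.preOp (v * w) = J.preOp v * J.preOp w :=
  ContinuousLinearMap.ext fun u => congrArg (fun T => T u) (J.onPre_shift_mul v w)

/-- The operator `λ(v)` on the Hilbert module. -/
noncomputable def op (v : G) : J.hilbertModule →L[ℂ] J.hilbertModule :=
  extend (J.preOp v)

lemma op_k (v : G) (s : S) :
    J.op v (J.kernel.k s) = J.sigma v s • J.kernel.k (X.q v * s) := by
  rw [op, k, extend_toRK, k, toRK_smul]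
  exact congrArg toRK ((J.shift v).onPre_preCol s)

lemma op_mul (v w : G) : J.op (v * w) = J.op v * J.op w := by
  rw [op, preOp_mul, extend_mul, op, op]

lemma isAdjointOf_op (v : G) :
    IsAdjointOf (DAlg S) J.hilbertModule (J.op (dag v)) (J.op v) :=
  isAdjointOf_extend (J.inner_onPre_shift_left v)

lemma op_injective : Function.Injective J.op := by
  intro v w h
  refine J.eq_of_sigma_mul_kernelFun_eq fun s t => ?_
  have heval := congrArg (fun T => J.kernel.eval (T (J.kernel.k s)) t) h
  simp only [op_k, eval_smul_k] at heval
  exact heval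

/-- The representation `λ` of the extension by adjointable operators. -/
noncomputable def rep : G →ₙ* adjointableOperators (DAlg S) J.hilbertModule where
  toFun v := ⟨J.op v, J.op (dag v), J.isAdjointOf_op v⟩
  map_mul' v w := Subtype.ext (J.op_mul v w)

end OrderPreservingSection

theorem theorem4p11 {S : Type u} [BooleanInverseMonoid S] {G : Type v} [InverseSemigroup G]
    (X : BooleanExtension S G) (J : OrderPreservingSection X) :
    Dense (Submodule.span ℂ (Set.range J.kernel.k) : Set J.hilbertModule) ∧
    ∃ lam : G →ₙ* adjointableOperators (DAlg S) J.hilbertModule,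
      (∀ (v : G) (s : S),
        (lam v).1 (J.kernel.k s) = J.sigma v s • J.kernel.k (X.q v * s)) ∧
      (∀ (v : G) (T : J.hilbertModule →L[ℂ] J.hilbertModule),
        (∀ s : S, T (J.kernel.k s) = J.sigma v s • J.kernel.k (X.q v * s)) → T = (lam v).1) ∧
      (∀ v : G, IsPartialIsometryOp (DAlg S) J.hilbertModule (lam v)) ∧
      (∀ v : G, IsAdjointOf (DAlg S) J.hilbertModule (lam (dag v)).1 (lam v).1) ∧
      Function.Injective lam := by
  refine ⟨J.dense_span_k, J.rep, J.op_k, fun v T hT => ?_,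
    fun v => ⟨J.rep (dag v), J.isAdjointOf_op v, ?_⟩, J.isAdjointOf_op,
    fun v w h => J.op_injective (congrArg Subtype.val h)⟩
  · refine ContinuousLinearMap.ext_on J.dense_span_k ?_
    rintro _ ⟨s, rfl⟩
    exact (hT s).trans (J.op_k v s).symm
  · rw [← map_mul, ← map_mul, mul_dag_mul]
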